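/- All rings are commutative with $1$. A ring homomorphism $f:A\to B$ has the \emph{stable prime extension property} if for every $n\ge 0$ and every prime ideal $P$ of $A[X_1,\dots,X_n]$, the extended ideal $P\,B[X_1,\dots,X_n]$ is prime or the unit ideal. Let $(\Sigma,\preceq)$ be a nonempty partially ordered set such that (i) for every $\sigma\in\Sigma$ the set $\{\tau\in\Sigma:\tau\preceq\sigma\}$ is finite and totally ordered, and (ii) every $\sigma\in\Sigma$ is the immediate predecessor of two incomparable elements of $\Sigma$. By (i), every element $\tau$ of the set $\Sigma_+$ of nonminimal elements of $\Sigma$ has a unique immediate predecessor $\tau_-$. Let $K$ be a field, let $$R=K[X_\sigma:\sigma\in\Sigma_+]\,/\,(X_\sigma X_\tau:\ \sigma,\tau\in\Sigma_+\text{ incomparable}),$$ let $x_\sigma$ be the image of $X_\sigma$ in $R$, and let $\mathfrak m=(x_\sigma:\sigma\in\Sigma_+)$, the homogeneous maximal ideal of $R$. Let $M$ be the quotient of the free $R$-module with basis $\{U_\sigma:\sigma\in\Sigma\}$ by the submodule spanned by the elements $U_{\tau_-}-x_\tau U_\tau$, $\tau\in\Sigma_+$. Let $R\ltimes M$ be the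 ring $R\oplus M$ with multiplication $(r\oplus m)(r'\oplus m')=rr'\oplus(rm'+r'm)$. (The ideal $\mathfrak m(R\ltimes M)$ of $R\ltimes M$ is prime and lies over $\mathfrak m$.) \textbf{Theorem.} The map $R_{\mathfrak m}\to(R\ltimes M)_{\mathfrak m(R\ltimes M)}$ induced by $R\to R\ltimes M$ is a local homomorphism of quasilocal rings (that is, rings with exactly one maximal ideal), its source $R_{\mathfrak m}$ is reduced, and it has the stable prime extension property, but it is not flat. Consequently it is not true that every ring homomorphism with reduced source and the stable prime extension property is flat; that is, in the theorem asserting flatness when the source is a reduced ring each of whose maximal ideals contains only finitely many minimal primes, the hypothesis on the minimal primes cannot be dropped. -/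

import Mathlib

/-- `R → S` has the prime extension property: every prime ideal of `R` extends to a prime ideal of
`S` or to the unit ideal of `S`. -/
def PrimeExtension {A B : Type*} [CommRing A] [CommRing B] (f : A →+* B) : Prop :=
  ∀ P : Ideal A, P.IsPrime → (P.map f).IsPrime ∨ P.map f = ⊤

/-- The stable prime extension property: `R[X₁, …, Xₙ] → S[X₁, …, Xₙ]` has the prime extension
property for every `n`. -/
def StablePrimeExtension {A B : Type*} [CommRing A] [CommRing B] (f : A →+* B) : Prop :=
  ∀ n : ℕ, PrimeExtension
    (MvPolynomial.map f : MvPolynomial (Fin n) A →+* MvPolynomial (Fin n) B)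

/-- The tree-like posets: nonempty, the elements below a given one form a finite chain, and every
element is the immediate predecessor of two incomparable elements. -/
class IsTreeLike (T : Type*) [PartialOrder T] : Prop where
  nonempty : Nonempty T
  finite_Iic : ∀ σ : T, (Set.Iic σ).Finite
  isChain_Iic : ∀ σ : T, IsChain (· ≤ ·) (Set.Iic σ)
  exists_incomparable_covers :
    ∀ σ : T, ∃ τ τ' : T, σ ⋖ τ ∧ σ ⋖ τ' ∧ ¬ τ ≤ τ' ∧ ¬ τ' ≤ τ

noncomputable section

namespace TreeExample

open TrivSqZeroExt

universe u v

/-- The set of nonminimal elements. -/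
abbrev NonMin (T : Type u) [PartialOrder T] : Type u := {σ : T // ¬ IsMin σ}

/-- The ideal generated by the products of two variables with incomparable indices. -/
def relIdeal (K : Type v) [Field K] (T : Type u) [PartialOrder T] :
    Ideal (MvPolynomial (NonMin T) K) :=
  Ideal.span {p | ∃ σ τ : NonMin T, ¬ σ ≤ τ ∧ ¬ τ ≤ σ ∧
    p = MvPolynomial.X σ * MvPolynomial.X τ}

/-- The ring `R = K[X_σ] / (X_σ X_τ : σ, τ incomparable)`. -/
def R (K : Type v) [Field K] (T : Type u) [PartialOrder T] : Type (max u v) :=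
  MvPolynomial (NonMin T) K ⧸ relIdeal K T

instance (K : Type v) [Field K] (T : Type u) [PartialOrder T] : CommRing (R K T) :=
  inferInstanceAs (CommRing (MvPolynomial (NonMin T) K ⧸ relIdeal K T))

/-- The quotient map `K[X_σ] → R`. -/
def mkR (K : Type v) [Field K] (T : Type u) [PartialOrder T] :
    MvPolynomial (NonMin T) K →+* R K T :=
  Ideal.Quotient.mk (relIdeal K T)

theorem mkR_surjective (K : Type v) [Field K] (T : Type u) [PartialOrder T] :
    Function.Surjective (mkR K T) :=
  Ideal.Quotient.mk_surjective

/-- The image `x_σ` of `X_σ` in `R`. -/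
def x (K : Type v) [Field K] {T : Type u} [PartialOrder T] (σ : NonMin T) : R K T :=
  mkR K T (MvPolynomial.X σ)

/-- The submodule of the free module on `{U_σ}` spanned by all `U_σ - x_τ U_τ`, where `σ` is the
immediate predecessor of `τ`. -/
def relSubmodule (K : Type v) [Field K] (T : Type u) [PartialOrder T] :
    Submodule (R K T) (T →₀ R K T) :=
  Submodule.span (R K T) {m | ∃ (σ : T) (τ : NonMin T), σ ⋖ τ.1 ∧
    m = Finsupp.single σ 1 - x K τ • Finsupp.single τ.1 1}

/-- The module `M`. -/
def M (K : Type v) [Field K] (T : Type u) [PartialOrder T] : Type (max u v) :=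
  (T →₀ R K T) ⧸ relSubmodule K T

instance (K : Type v) [Field K] (T : Type u) [PartialOrder T] : AddCommGroup (M K T) :=
  inferInstanceAs (AddCommGroup ((T →₀ R K T) ⧸ relSubmodule K T))

instance (K : Type v) [Field K] (T : Type u) [PartialOrder T] : Module (R K T) (M K T) :=
  inferInstanceAs (Module (R K T) ((T →₀ R K T) ⧸ relSubmodule K T))

/-- The same action, written on the right. -/
instance (K : Type v) [Field K] (T : Type u) [PartialOrder T] : Module (R K T)ᵐᵒᵖ (M K T) :=
  Module.compHom (M K T) ((RingHom.id (R K T)).fromOpposite fun _ _ => mul_comm _ _)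

instance (K : Type v) [Field K] (T : Type u) [PartialOrder T] :
    IsCentralScalar (R K T) (M K T) :=
  ⟨fun _ _ => rfl⟩

/-- The quotient map from the free module to `M`. -/
def mkM (K : Type v) [Field K] (T : Type u) [PartialOrder T] :
    (T →₀ R K T) →ₗ[R K T] M K T :=
  (relSubmodule K T).mkQ

theorem mkM_surjective (K : Type v) [Field K] (T : Type u) [PartialOrder T] :
    Function.Surjective (mkM K T) :=
  (relSubmodule K T).mkQ_surjective

/-- The image `u_σ` of `U_σ` in `M`. -/
def gen (K : Type v) [Field K] {T : Type u} [PartialOrder T] (σ : T) : M K T :=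
  mkM K T (Finsupp.single σ 1)

/-- The idealization `R ⋉ M`: the ring `R ⊕ M` with `M² = 0`. -/
abbrev S (K : Type v) [Field K] (T : Type u) [PartialOrder T] : Type (max u v) :=
  TrivSqZeroExt (R K T) (M K T)

/-- The homogeneous maximal ideal `𝔪` of `R`, generated by all `x_σ`. -/
def 𝔪 (K : Type v) [Field K] (T : Type u) [PartialOrder T] : Ideal (R K T) :=
  Ideal.span (Set.range (x K))

/-- The extended ideal `𝔪(R ⋉ M)`. -/
def 𝔪S (K : Type v) [Field K] (T : Type u) [PartialOrder T] : Ideal (S K T) :=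
  (𝔪 K T).map (algebraMap (R K T) (S K T))

variable (K : Type v) [Field K] (T : Type u) [PartialOrder T]

/-- The augmentation `R → K` sending all `x_σ` to `0`. -/
def aug : R K T →+* K :=
  Ideal.Quotient.lift (relIdeal K T) MvPolynomial.constantCoeff (by
    intro p hp
    have h : relIdeal K T ≤ RingHom.ker (MvPolynomial.constantCoeff (R := K)) := by
      refine Ideal.span_le.2 ?_
      rintro _ ⟨σ, τ, -, -, rfl⟩
      simp [RingHom.mem_ker]
    exact h hp)

theorem ker_aug : RingHom.ker (aug K T) = 𝔪 K T := by
  apply le_antisymm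
  · intro r hr
    obtain ⟨p, rfl⟩ := mkR_surjective K T r
    have hc : MvPolynomial.constantCoeff p = 0 := hr
    have key : ∀ q : MvPolynomial (NonMin T) K, mkR K T
        (q - MvPolynomial.C (MvPolynomial.constantCoeff q)) ∈ 𝔪 K T := by
      intro q
      induction q using MvPolynomial.induction_on with
      | C a => simp
      | add p q hp hq =>
        have := (𝔪 K T).add_mem hp hq
        rw [← map_add] at this
        convert this using 2
        simp only [map_add]
        ring
      | mul_X p i _ =>
        have hx : x K i ∈ 𝔪 K T := Ideal.subset_span ⟨i, rfl⟩
        have := (𝔪 K T).mul_mem_left (mkR K T p) hx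
        simpa [x] using this
    simpa [hc] using key p
  · refine Ideal.span_le.2 ?_
    rintro _ ⟨σ, rfl⟩
    exact MvPolynomial.constantCoeff_X (R := K) σ

instance : (𝔪 K T).IsMaximal := by
  rw [← ker_aug]
  refine RingHom.ker_isMaximal_of_surjective _ fun a => ?_
  exact ⟨mkR K T (MvPolynomial.C a), MvPolynomial.constantCoeff_C _ a⟩

theorem inr_mem_𝔪S [IsTreeLike T] (m : M K T) : (inr m : S K T) ∈ 𝔪S K T := by
  obtain ⟨f, rfl⟩ := mkM_surjective K T m
  induction f using Finsupp.induction_linear with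
  | zero => simp
  | add f g hf hg =>
    rw [map_add, inr_add]
    exact (𝔪S K T).add_mem hf hg
  | single σ r =>
    obtain ⟨τ, -, hτ, -⟩ := IsTreeLike.exists_incomparable_covers σ
    let t : NonMin T := ⟨τ, fun h => hτ.lt.not_isMin h⟩
    have h1 : gen K σ = x K t • gen K τ := by
      rw [gen, gen, ← map_smul, ← sub_eq_zero, ← map_sub]
      exact (Submodule.Quotient.mk_eq_zero _).2 (Submodule.subset_span ⟨σ, t, hτ, rfl⟩)
    have h2 : mkM K T (Finsupp.single σ r) = x K t • (r • gen K τ) := by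
      rw [smul_comm, ← h1, gen, ← map_smul]
      simp
    have h3 : (inr (x K t • (r • gen K τ)) : S K T) = inr (r • gen K τ) * inl (x K t) := by
      exact ((mul_comm _ _).trans (inl_mul_inr (x K t) (r • gen K τ))).symm
    rw [h2, h3]
    exact Ideal.mul_mem_left _ _ (Ideal.mem_map_of_mem (algebraMap (R K T) (S K T))
      (Ideal.subset_span ⟨t, rfl⟩))

theorem 𝔪S_eq [IsTreeLike T] :
    𝔪S K T = (𝔪 K T).comap (fstHom (R K T) (R K T) (M K T)).toRingHom := by
  apply le_antisymm
  · refine Ideal.map_le_iff_le_comap.2 fun r hr => ?_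
    simpa [Ideal.mem_comap] using hr
  · intro s hs
    rw [← inl_fst_add_inr_snd_eq s]
    exact (𝔪S K T).add_mem (Ideal.mem_map_of_mem (algebraMap (R K T) (S K T)) hs)
      (inr_mem_𝔪S K T _)

instance [IsTreeLike T] : (𝔪S K T).IsPrime := by
  rw [𝔪S_eq]
  infer_instance

theorem 𝔪_eq_comap [IsTreeLike T] :
    𝔪 K T = (𝔪S K T).comap (algebraMap (R K T) (S K T)) := by
  rw [𝔪S_eq]
  ext r
  simp [Ideal.mem_comap]

/-- The local ring `R_𝔪`. -/
abbrev Rloc : Type (max u v) := Localization.AtPrime (𝔪 K T)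

/-- The local ring `(R ⋉ M)_{𝔪(R ⋉ M)}`. -/
abbrev Sloc [IsTreeLike T] : Type (max u v) := Localization.AtPrime (𝔪S K T)

/-- The map `R_𝔪 → (R ⋉ M)_{𝔪(R ⋉ M)}` induced by `R → R ⋉ M`. -/
def φ [IsTreeLike T] : Rloc K T →+* Sloc K T :=
  Localization.localRingHom (𝔪 K T) (𝔪S K T) (algebraMap (R K T) (S K T)) (𝔪_eq_comap K T)

end TreeExample

end

/-! Write `u_σ` for `gen K σ`. If `σ` has incomparable covers `τ`, `τ'`, then `x_τ x_τ' = 0`, so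
every prime `p` contains `x_τ` or `x_τ'`; since `u_σ = x_τ u_τ = x_τ' u_τ'`, this gives `M = pM`
(`algebraMap_inr_mem`). Thus the kernel of the projection back to the base lies in every extended
prime. Checking coefficients, the extension of a prime `P` of a polynomial ring is its preimage
under the projection, hence prime (`StablePrimeExtension.of_retraction`).

Flatness fails because `x_τ² u_τ = x_τ u_σ = x_τ x_τ' u_τ' = 0`: over a reduced base it would force
`u_σ = x_τ u_τ = 0` in the localization. For minimal `σ` a functional on `M` built from chain
monomials rules this out (`mem_𝔪_of_smul_gen_eq_zero`). -/

/-! ### Criteria for ring homomorphisms. -/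

section TrivialExtension

/-- If `ψ` is a retraction of `f` whose kernel is contained in the extension of every prime, then
`f` has the stable prime extension property. -/
theorem StablePrimeExtension.of_retraction {A B : Type*} [CommRing A] [CommRing B] (f : A →+* B)
    (ψ : B →+* A) (hψ : ∀ a, ψ (f a) = a)
    (hker : ∀ p : Ideal A, p.IsPrime → RingHom.ker ψ ≤ p.map f) : StablePrimeExtension f := by
  intro n P hP
  left
  suffices h : P.map (MvPolynomial.map f : MvPolynomial (Fin n) A →+* _) =
      P.comap (MvPolynomial.map ψ) by
    rw [h]
    infer_instance
  have hcomp : ∀ g : MvPolynomial (Fin n) A,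
      MvPolynomial.map ψ (MvPolynomial.map f g) = g := by
    intro g
    rw [MvPolynomial.map_map, show ψ.comp f = RingHom.id A from RingHom.ext hψ,
      MvPolynomial.map_id]
  apply le_antisymm
  · refine Ideal.map_le_iff_le_comap.2 fun g hg => ?_
    rw [Ideal.mem_comap, Ideal.mem_comap, hcomp]
    exact hg
  · intro g hg
    -- Each coefficient lies in `ker ψ`, hence in the extension of the prime `P ∩ A`.
    have hsub : g - MvPolynomial.map f (MvPolynomial.map ψ g) ∈ P.map (MvPolynomial.map f) := by
      have h1 : g - MvPolynomial.map f (MvPolynomial.map ψ g) ∈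
          ((P.comap MvPolynomial.C).map f).map (MvPolynomial.C (σ := Fin n)) := by
        rw [MvPolynomial.mem_map_C_iff]
        intro m
        refine hker _ inferInstance ?_
        rw [RingHom.mem_ker, ← MvPolynomial.coeff_map, map_sub, hcomp, sub_self,
          MvPolynomial.coeff_zero]
      have h2 : ((P.comap MvPolynomial.C).map f).map (MvPolynomial.C (σ := Fin n)) ≤
          P.map (MvPolynomial.map f) := by
        rw [Ideal.map_map, Ideal.map_le_iff_le_comap]
        intro a ha
        have h3 := Ideal.mem_map_of_mem (MvPolynomial.map f) (Ideal.mem_comap.1 ha)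
        rwa [MvPolynomial.map_C] at h3
      exact h2 h1
    have h4 := Ideal.add_mem _ hsub (Ideal.mem_map_of_mem (MvPolynomial.map f) hg)
    rwa [sub_add_cancel] at h4

/-- Along a flat ring homomorphism with reduced source, `f a ^ 2 * b = 0` implies
`f a * b = 0`. -/
theorem RingHom.Flat.mul_eq_zero_of_sq_mul_eq_zero {A B : Type*} [CommRing A] [CommRing B]
    [IsReduced A] {f : A →+* B} (hf : f.Flat) {a : A} {b : B} (h : f a ^ 2 * b = 0) :
    f a * b = 0 := by
  let _ : Algebra A B := f.toAlgebra
  have : Module.Flat A B := hf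
  have hsum : ∑ _i : Unit, (a ^ 2) • b = 0 := by
    simpa [Algebra.smul_def, RingHom.algebraMap_toAlgebra] using h
  -- Equational criterion: `b = ∑ c_j y_j` with `a² c_j = 0`. Then `(a c_j)² = 0`, so `a c_j = 0`.
  obtain ⟨k, c, y, hy, hc⟩ := Module.Flat.isTrivialRelation_of_sum_smul_eq_zero
    (f := fun _ : Unit => a ^ 2) (x := fun _ => b) hsum
  have hb : a • b = 0 := by
    rw [show b = _ from hy (), Finset.smul_sum]
    refine Finset.sum_eq_zero fun j _ => ?_
    have h1 : a ^ 2 * c () j = 0 := by simpa using hc j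
    have h2 : a * c () j = 0 := by
      refine IsReduced.eq_zero _ ⟨2, ?_⟩
      linear_combination c () j * h1
    rw [smul_smul, h2, zero_smul]
  simpa [Algebra.smul_def, RingHom.algebraMap_toAlgebra] using hb

end TrivialExtension

/-! ### Tree-like posets. -/

namespace IsTreeLike

variable {T : Type*} [PartialOrder T] [IsTreeLike T]

theorem exists_isMin : ∃ σ : T, IsMin σ := by
  obtain ⟨σ⟩ := IsTreeLike.nonempty (T := T)
  obtain ⟨ρ, hρσ, hρ⟩ := (finite_Iic σ).exists_le_minimal (Set.mem_Iic.2 le_rfl)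
  exact ⟨ρ, fun τ hτ => hρ.2 (hτ.trans hρσ) hτ⟩

theorem le_iff_of_covBy {σ τ ρ : T} (h : σ ⋖ τ) : ρ ≤ τ ↔ ρ = τ ∨ ρ ≤ σ := by
  constructor
  · intro hρ
    rcases (isChain_Iic τ).total (Set.mem_Iic.2 hρ) (Set.mem_Iic.2 h.le) with h1 | h1
    · exact Or.inr h1
    · rcases h.eq_or_eq h1 hρ with h2 | h2
      · exact Or.inr h2.le
      · exact Or.inl h2
  · rintro (rfl | h1)
    · exact le_rfl
    · exact h1.trans h.le

end IsTreeLike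

noncomputable section

namespace TreeExample

open TrivSqZeroExt

universe u v

variable (K : Type v) [Field K] (T : Type u) [PartialOrder T]

/-! ### The monomial ideal of relations; `R` is reduced. -/

theorem mem_relIdeal_iff {p : MvPolynomial (NonMin T) K} :
    p ∈ relIdeal K T ↔ ∀ d ∈ p.support, ∃ σ τ : NonMin T, ¬ σ ≤ τ ∧ ¬ τ ≤ σ ∧
      d σ ≠ 0 ∧ d τ ≠ 0 := by
  classical
  have h : relIdeal K T = Ideal.span ((fun s => MvPolynomial.monomial s (1 : K)) ''
      {d : NonMin T →₀ ℕ | ∃ σ τ : NonMin T, ¬ σ ≤ τ ∧ ¬ τ ≤ σ ∧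
        d = Finsupp.single σ 1 + Finsupp.single τ 1}) := by
    rw [relIdeal]
    congr 1
    ext p
    simp only [Set.mem_ofPred_eq, Set.mem_image]
    constructor
    · rintro ⟨σ, τ, h1, h2, rfl⟩
      exact ⟨_, ⟨σ, τ, h1, h2, rfl⟩, by simp [MvPolynomial.X, MvPolynomial.monomial_mul]⟩
    · rintro ⟨_, ⟨σ, τ, h1, h2, rfl⟩, rfl⟩
      exact ⟨σ, τ, h1, h2, by simp [MvPolynomial.X, MvPolynomial.monomial_mul]⟩
  rw [h, MvPolynomial.mem_ideal_span_monomial_image]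
  refine forall₂_congr fun d _ => ?_
  constructor
  · rintro ⟨_, ⟨σ, τ, h1, h2, rfl⟩, hle⟩
    have hσ := hle σ
    have hτ := hle τ
    simp only [Finsupp.add_apply, Finsupp.single_eq_same] at hσ hτ
    exact ⟨σ, τ, h1, h2, by omega, by omega⟩
  · rintro ⟨σ, τ, h1, h2, hσ, hτ⟩
    refine ⟨_, ⟨σ, τ, h1, h2, rfl⟩, fun ρ => ?_⟩
    have hne : σ ≠ τ := fun h => h1 h.le
    rw [Finsupp.add_apply, Finsupp.single_apply, Finsupp.single_apply]
    split_ifs with h3 h4 h4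
    · exact absurd (h3.trans h4.symm) hne
    · subst h3; omega
    · subst h4; omega
    · omega

/-- If a monomial `d` of `p` has pairwise comparable indices, setting all variables outside its
support to zero kills the ideal but not `d`. The target is a domain, so no power of `p` lies in the
ideal. -/
theorem relIdeal_isRadical : (relIdeal K T).IsRadical := by
  classical
  rintro p ⟨n, hn⟩
  rw [mem_relIdeal_iff]
  intro d hd
  by_contra! hcon
  let e : d.support → NonMin T := Subtype.val
  have he : Function.Injective e := Subtype.val_injective
  have hker : relIdeal K T ≤ RingHom.ker (MvPolynomial.killCompl (R := K) he) := by
    intro q hq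
    rw [RingHom.mem_ker]
    ext s
    rw [MvPolynomial.coeff_killCompl, MvPolynomial.coeff_zero]
    by_contra hs
    obtain ⟨σ, τ, h1, h2, hσ, hτ⟩ :=
      (mem_relIdeal_iff K T).1 hq _ (MvPolynomial.mem_support_iff.2 hs)
    have hmem : ∀ ρ : NonMin T, s.mapDomain e ρ ≠ 0 → d ρ ≠ 0 := by
      intro ρ hρ
      obtain ⟨a, rfl⟩ : ρ ∈ Set.range e := by
        by_contra hn
        exact hρ (Finsupp.mapDomain_of_notMem_range _ _ hn)
      exact Finsupp.mem_support_iff.1 a.2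
    exact hmem τ hτ (hcon σ τ h1 h2 (hmem σ hσ))
  have hp : MvPolynomial.killCompl (R := K) he p = 0 := by
    have := hker hn
    rw [RingHom.mem_ker, map_pow] at this
    exact eq_zero_of_pow_eq_zero this
  have hc := congrArg (MvPolynomial.coeff (d.comapDomain e he.injOn)) hp
  rw [MvPolynomial.coeff_killCompl, MvPolynomial.coeff_zero,
    Finsupp.mapDomain_comapDomain _ he _ (by intro a ha; exact ⟨⟨a, ha⟩, rfl⟩)] at hc
  exact MvPolynomial.mem_support_iff.1 hd hc

instance : IsReduced (R K T) :=
  (Ideal.isRadical_iff_quotient_reduced _).1 (relIdeal_isRadical K T)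

variable {T}

theorem x_mul_x {σ τ : NonMin T} (h1 : ¬ σ ≤ τ) (h2 : ¬ τ ≤ σ) : x K σ * x K τ = 0 := by
  rw [x, x, ← map_mul]
  exact Ideal.Quotient.eq_zero_iff_mem.2 (Ideal.subset_span ⟨σ, τ, h1, h2, rfl⟩)

theorem gen_eq_smul {σ : T} {τ : NonMin T} (h : σ ⋖ τ.1) : gen K σ = x K τ • gen K τ.1 := by
  rw [gen, gen, ← map_smul, ← sub_eq_zero, ← map_sub]
  exact (Submodule.Quotient.mk_eq_zero _).2 (Submodule.subset_span ⟨σ, τ, h, rfl⟩)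

/-! ### Chain monomials and annihilators in `M`. -/

/-- The exponent of the product of all variables with index `≤ σ`. -/
def chainExponent [IsTreeLike T] (σ : T) : NonMin T →₀ ℕ :=
  open Classical in
  Finsupp.ofSupportFinite (fun τ => if τ.1 ≤ σ then 1 else 0) <| by
    refine ((IsTreeLike.finite_Iic σ).preimage Subtype.val_injective.injOn).subset fun τ hτ => ?_
    by_contra h
    exact hτ (if_neg h)

open Classical in
theorem chainExponent_apply [IsTreeLike T] (σ : T) (τ : NonMin T) :
    chainExponent σ τ = if τ.1 ≤ σ then 1 else 0 := rfl

theorem chainExponent_of_isMin [IsTreeLike T] {σ : T} (h : IsMin σ) :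
    chainExponent σ = 0 := by
  ext τ
  rw [chainExponent_apply, Finsupp.zero_apply, if_neg]
  intro hτ
  exact τ.2 ((h.eq_of_le hτ) ▸ h)

theorem chainExponent_of_covBy [IsTreeLike T] {σ : T} {τ : NonMin T} (h : σ ⋖ τ.1) :
    chainExponent τ.1 = Finsupp.single τ 1 + chainExponent σ := by
  classical
  ext ρ
  simp only [Finsupp.add_apply, chainExponent_apply, Finsupp.single_apply,
    IsTreeLike.le_iff_of_covBy h, Subtype.ext_iff, eq_comm (a := τ.1)]
  by_cases h1 : ρ.1 = τ.1
  · simp [h1, h.lt.not_ge]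
  · simp [h1]

/-- The coefficient of the product of all `x_τ` with `τ ≤ σ`, as a functional on `R`. -/
def chainCoeff [IsTreeLike T] (σ : T) : R K T →+ K :=
  QuotientAddGroup.lift (relIdeal K T).toAddSubgroup
    (MvPolynomial.lcoeff K (chainExponent σ)).toAddMonoidHom <| by
    intro p hp
    by_contra hne
    obtain ⟨τ, τ', h1, h2, hτ, hτ'⟩ :=
      (mem_relIdeal_iff K T).1 hp _ (MvPolynomial.mem_support_iff.2 hne)
    rw [chainExponent_apply] at hτ hτ'
    have h3 : τ.1 ≤ σ := by by_contra h; exact hτ (if_neg h)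
    have h4 : τ'.1 ≤ σ := by by_contra h; exact hτ' (if_neg h)
    exact ((IsTreeLike.isChain_Iic σ).total h3 h4).elim h1 h2

theorem chainCoeff_mkR [IsTreeLike T] (σ : T) (p : MvPolynomial (NonMin T) K) :
    chainCoeff K σ (mkR K T p) = p.coeff (chainExponent σ) := rfl

theorem chainCoeff_of_isMin [IsTreeLike T] {σ : T} (h : IsMin σ) (r : R K T) :
    chainCoeff K σ r = aug K T r := by
  obtain ⟨p, rfl⟩ := mkR_surjective K T r
  rw [chainCoeff_mkR, chainExponent_of_isMin h]
  rfl

/-- The chain monomial of `τ` is `x_τ` times that of `σ`; this makes the functionals respect the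
relations of `M`. -/
theorem chainCoeff_mul_x [IsTreeLike T] {σ : T} {τ : NonMin T} (h : σ ⋖ τ.1) (r : R K T) :
    chainCoeff K τ.1 (r * x K τ) = chainCoeff K σ r := by
  obtain ⟨p, rfl⟩ := mkR_surjective K T r
  rw [x, ← map_mul, chainCoeff_mkR, chainCoeff_mkR, chainExponent_of_covBy h, mul_comm,
    MvPolynomial.coeff_X_mul]

/-- No element outside `𝔪` kills the generator at a minimal index. -/
theorem mem_𝔪_of_smul_gen_eq_zero [IsTreeLike T] {σ : T} (h : IsMin σ) {r : R K T}
    (hr : r • gen K σ = 0) : r ∈ 𝔪 K T := by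
  let L : (T →₀ R K T) →+ K := Finsupp.liftAddHom (chainCoeff K)
  -- `L` is not `R`-linear, so the induction must carry an arbitrary multiplier `a`.
  have hL : ∀ m ∈ relSubmodule K T, ∀ a : R K T, L (a • m) = 0 := by
    intro m hm
    induction hm using Submodule.span_induction with
    | mem m hm =>
      obtain ⟨σ, τ, hστ, rfl⟩ := hm
      intro a
      rw [smul_sub, map_sub, Finsupp.smul_single, smul_smul, Finsupp.smul_single, smul_eq_mul,
        smul_eq_mul, mul_one, mul_one, Finsupp.liftAddHom_apply_single,
        Finsupp.liftAddHom_apply_single, chainCoeff_mul_x K hστ, sub_self]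
    | zero => simp
    | add m m' _ _ h1 h2 =>
      intro a
      rw [smul_add, map_add, h1, h2, add_zero]
    | smul b m _ h1 =>
      intro a
      rw [smul_smul, h1]
  rw [gen, ← map_smul] at hr
  have h1 := hL _ ((Submodule.Quotient.mk_eq_zero _).1 hr) 1
  rw [one_smul, Finsupp.smul_single, smul_eq_mul, mul_one, Finsupp.liftAddHom_apply_single,
    chainCoeff_of_isMin K h] at h1
  rw [← ker_aug]
  exact h1

/-! ### The localized map: prime extension and failure of flatness. -/

variable (T)

/-- The retraction of `φ` induced by the projection `R ⋉ M → R`. -/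
def retraction [IsTreeLike T] : Sloc K T →+* Rloc K T :=
  Localization.localRingHom (𝔪S K T) (𝔪 K T) (fstHom (R K T) (R K T) (M K T)).toRingHom
    (𝔪S_eq K T)

theorem φ_algebraMap [IsTreeLike T] (r : R K T) :
    φ K T (algebraMap _ _ r) = algebraMap (S K T) (Sloc K T) (inl r) :=
  Localization.localRingHom_to_map _ _ _ _ _

theorem retraction_φ [IsTreeLike T] (a : Rloc K T) : retraction K T (φ K T a) = a := by
  have h : (retraction K T).comp (φ K T) = RingHom.id _ := by
    refine IsLocalization.ringHom_ext (𝔪 K T).primeCompl (RingHom.ext fun r => ?_)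
    simp only [RingHom.comp_apply, φ_algebraMap, RingHom.id_apply, retraction,
      Localization.localRingHom_to_map]
    rfl
  exact RingHom.congr_fun h a

theorem algebraMap_inr_mem [IsTreeLike T] (p : Ideal (Rloc K T)) [hp : p.IsPrime] (m : M K T) :
    algebraMap (S K T) (Sloc K T) (inr m) ∈ p.map (φ K T) := by
  obtain ⟨f, rfl⟩ := mkM_surjective K T m
  induction f using Finsupp.induction_linear with
  | zero => simp
  | add f g hf hg =>
    rw [map_add, inr_add, map_add]
    exact Ideal.add_mem _ hf hg
  | single σ r =>
    obtain ⟨t, ht, hmem⟩ : ∃ t : NonMin T, σ ⋖ t.1 ∧ algebraMap _ (Rloc K T) (x K t) ∈ p := by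
      obtain ⟨τ, τ', hτ, hτ', h1, h2⟩ := IsTreeLike.exists_incomparable_covers σ
      let t : NonMin T := ⟨τ, fun h => hτ.lt.not_isMin h⟩
      let t' : NonMin T := ⟨τ', fun h => hτ'.lt.not_isMin h⟩
      have h0 : algebraMap _ (Rloc K T) (x K t) * algebraMap _ (Rloc K T) (x K t') ∈ p := by
        rw [← map_mul, x_mul_x K (σ := t) (τ := t') h1 h2, map_zero]
        exact p.zero_mem
      exact (hp.mem_or_mem h0).elim (fun h => ⟨t, hτ, h⟩) (fun h => ⟨t', hτ', h⟩)
    have h2 : mkM K T (Finsupp.single σ r) = x K t • (r • gen K t.1) := by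
      rw [smul_comm, ← gen_eq_smul K ht, gen, ← map_smul]
      simp
    rw [h2, ← inl_mul_inr, map_mul, ← φ_algebraMap]
    exact Ideal.mul_mem_right _ _ (Ideal.mem_map_of_mem _ hmem)

theorem ker_retraction_le [IsTreeLike T] (p : Ideal (Rloc K T)) [p.IsPrime] :
    RingHom.ker (retraction K T) ≤ p.map (φ K T) := by
  intro b hb
  obtain ⟨s, t, rfl⟩ := IsLocalization.exists_mk'_eq (𝔪S K T).primeCompl b
  rw [RingHom.mem_ker, retraction, Localization.localRingHom_mk',
    IsLocalization.mk'_eq_zero_iff] at hb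
  obtain ⟨r, hr⟩ := hb
  -- Multiplying by the unit `r` kills the first component of `s`, leaving an element of `M`.
  have hu : IsUnit (algebraMap (S K T) (Sloc K T) (inl r.1)) := by
    rw [← φ_algebraMap]
    exact (IsLocalization.map_units (Rloc K T) r).map (φ K T)
  have hs : inl r.1 * s = inr (r.1 • s.snd) := by
    ext
    · simpa using hr
    · simp
  rw [IsLocalization.mk'_eq_mul_mk'_one]
  refine Ideal.mul_mem_right _ _ ((Ideal.unit_mul_mem_iff_mem _ hu).1 ?_)
  rw [← map_mul, hs]
  exact algebraMap_inr_mem K T p _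

theorem stablePrimeExtension_φ [IsTreeLike T] : StablePrimeExtension (φ K T) :=
  StablePrimeExtension.of_retraction _ (retraction K T) (retraction_φ K T)
    fun p _ => ker_retraction_le K T p

theorem not_flat_φ [IsTreeLike T] : ¬ (φ K T).Flat := by
  intro hf
  obtain ⟨σ, hσ⟩ := IsTreeLike.exists_isMin (T := T)
  obtain ⟨τ, τ', hτ, hτ', h1, h2⟩ := IsTreeLike.exists_incomparable_covers σ
  let t : NonMin T := ⟨τ, fun h => hτ.lt.not_isMin h⟩
  let t' : NonMin T := ⟨τ', fun h => hτ'.lt.not_isMin h⟩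
  have hkill : x K t ^ 2 • gen K τ = 0 := by
    rw [pow_two, mul_smul, ← gen_eq_smul K (τ := t) hτ, gen_eq_smul K (τ := t') hτ', smul_smul,
      x_mul_x K (σ := t) (τ := t') h1 h2, zero_smul]
  have hzero : φ K T (algebraMap _ _ (x K t)) * algebraMap _ _ (inr (gen K τ) : S K T) = 0 := by
    refine hf.mul_eq_zero_of_sq_mul_eq_zero ?_
    rw [← map_pow, ← map_pow, φ_algebraMap, ← map_mul, inl_mul_inr, hkill, inr_zero, map_zero]
  rw [φ_algebraMap, ← map_mul, inl_mul_inr, ← gen_eq_smul K (τ := t) hτ,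
    IsLocalization.map_eq_zero_iff (𝔪S K T).primeCompl] at hzero
  obtain ⟨s, hs⟩ := hzero
  have h3 : s.1.fst • gen K σ = 0 := by simpa using congrArg TrivSqZeroExt.snd hs
  exact s.2 ((𝔪S_eq K T).ge (mem_𝔪_of_smul_gen_eq_zero K hσ h3))

end TreeExample

end

/-! ### A concrete tree. -/

/-- The infinite binary tree: finite binary words ordered by the prefix relation. -/
structure BinaryWord where
  /-- The underlying list of letters. -/
  toList : List Bool

namespace BinaryWord

instance : PartialOrder BinaryWord where
  le a b := a.toList <+: b.toList
  le_refl a := List.prefix_refl _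
  le_trans _ _ _ := List.IsPrefix.trans
  le_antisymm a b h1 h2 := by
    cases a
    cases b
    exact congrArg BinaryWord.mk (h1.eq_of_length (le_antisymm h1.length_le h2.length_le))

theorem le_def {a b : BinaryWord} : a ≤ b ↔ a.toList <+: b.toList := Iff.rfl

theorem covBy_append (a : BinaryWord) (i : Bool) : a ⋖ ⟨a.toList ++ [i]⟩ := by
  refine ⟨lt_of_le_not_ge (List.prefix_append _ _) fun h => ?_, fun c hac hcb => ?_⟩
  · simpa using h.length_le
  · have h1 : c.toList.length ≤ a.toList.length + 1 := by
      simpa using (le_def.1 hcb.le).length_le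
    -- An intermediate prefix has the length of one of the two ends, hence equals it.
    rcases Nat.lt_or_ge a.toList.length c.toList.length with h2 | h2
    · refine hcb.not_ge (le_def.2 ?_)
      rw [(le_def.1 hcb.le).eq_of_length (by simp; omega)]
    · refine hac.not_ge (le_def.2 ?_)
      rw [(le_def.1 hac.le).eq_of_length (le_antisymm (le_def.1 hac.le).length_le h2)]

theorem append_not_le (a : BinaryWord) {i j : Bool} (h : i ≠ j) :
    ¬ (⟨a.toList ++ [i]⟩ : BinaryWord) ≤ ⟨a.toList ++ [j]⟩ := by
  intro hle
  have h1 := (le_def.1 hle).eq_of_length (by simp)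
  exact h (by simpa using h1)

instance : IsTreeLike BinaryWord where
  nonempty := ⟨⟨[]⟩⟩
  finite_Iic σ := by
    refine ((List.finite_toSet σ.toList.inits).image BinaryWord.mk).subset fun τ hτ => ?_
    exact ⟨τ.toList, (List.mem_inits _ _).2 hτ, rfl⟩
  isChain_Iic _ _ ha _ hb _ := List.prefix_or_prefix_of_prefix ha hb
  exists_incomparable_covers σ :=
    ⟨_, _, covBy_append σ true, covBy_append σ false, append_not_le σ (by decide),
      append_not_le σ (by decide)⟩

end BinaryWord

theorem mainTheorem3 :
    (∀ (K : Type*) [Field K] (T : Type*) [PartialOrder T] [IsTreeLike T],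
      IsLocalRing (TreeExample.Rloc K T) ∧
      IsLocalRing (TreeExample.Sloc K T) ∧
      IsLocalHom (TreeExample.φ K T) ∧
      IsReduced (TreeExample.Rloc K T) ∧
      StablePrimeExtension (TreeExample.φ K T) ∧
      ¬ (TreeExample.φ K T).Flat) ∧
    ¬ (∀ (A B : Type) [CommRing A] [CommRing B] (f : A →+* B),
      IsReduced A → StablePrimeExtension f → f.Flat) := by
  refine ⟨fun K _ T _ _ => ⟨inferInstance, inferInstance, ?_, inferInstance,
    TreeExample.stablePrimeExtension_φ K T, TreeExample.not_flat_φ K T⟩, fun h => ?_⟩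
  · exact Localization.isLocalHom_localRingHom _ _ _ _
  · exact TreeExample.not_flat_φ ℚ BinaryWord
      (h _ _ _ inferInstance (TreeExample.stablePrimeExtension_φ ℚ BinaryWord))
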